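/- Let $D$ be an integral domain with quotient field $K$. Let $\mathrm{Over}(D)$ be the set of overrings of $D$ (rings $B$ with $D\subseteq B\subseteq K$), with the Zariski topology, a subbase of open sets of which is given by the sets $\{B : F\subseteq B\}$ for finite $F\subseteq K$. Let $\mathrm{Zar}(D)\subseteq\mathrm{Over}(D)$ and $\overline{\mathrm{Over}}(D)\subseteq\mathrm{Over}(D)$ be the subspaces of valuation overrings and of integrally closed overrings of $D$, respectively. For a spectral space $X$, let $\mathcal X(X)$ be the set of nonempty subsets $Y\subseteq X$ that are closed in the inverse topology, i.e. that equal the intersection of all quasi-compact open subsets of $X$ containing $Y$; endow $\mathcal X(X)$ with the topology having as a subbase of open sets the sets $\{Y\in\mathcal X(X) : Y\subseteq\Omega\}$, where $\Omega$ runs among the quasi-compact open subsets of $X$. The constructible topology on $X$ is the topology generated by the quasi-compact open subsets of $X$ and their complements. Then: 1. $\overline{\mathrm{Over}}(D)$ is a topological quotient of $\mathcal X(\mathrm{Zar}(D))$ via $Y\mapsto\bigcap_{V\in Y}V$: for every $Y\in\mathcal X(\mathrm{Zar}(D))$ this intersection is an integrally closed overring, and $Y\mapsto\bigcap_{V\in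 Y}V$ is a (surjective) topological quotient map from $\mathcal X(\mathrm{Zar}(D))$ onto $\overline{\mathrm{Over}}(D)$. 2. $\overline{\mathrm{Over}}(D)$ is closed in the constructible topology of $\mathrm{Over}(D)$, and it is a spectral space. 3. If $D$ is a Prüfer domain (every nonzero finitely generated ideal is invertible), then $Y\mapsto\bigcap_{V\in Y}V$ is a homeomorphism from $\mathcal X(\mathrm{Zar}(D))$ onto $\mathrm{Over}(D)$; in particular, $\mathrm{Over}(D)$ is homeomorphic to $\mathcal X(\mathrm{Zar}(D))$. -/

import Mathlib

open scoped nonZeroDivisors Topology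

/-- The overrings of `D`: the rings between the domain `D` and its quotient field `K`, i.e. the
`D`-subalgebras of `K`. -/
abbrev Overring (D K : Type*) [CommRing D] [Field K] [Algebra D K] : Type _ :=
  Subalgebra D K

/-- The Zariski topology on the space of overrings: a subbase of open sets is given by the sets
`{B | F ⊆ B}`, where `F` runs among the finite subsets of `K`. -/
instance Overring.zariskiTopology (D K : Type*) [CommRing D] [Field K] [Algebra D K] :
    TopologicalSpace (Overring D K) :=
  TopologicalSpace.generateFrom
    {U | ∃ F : Set K, F.Finite ∧ U = {B : Overring D K | F ⊆ (B : Set K)}}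

/-- The Riemann-Zariski space of `D`: the valuation overrings of `D`, with the subspace topology
(here `K` is the quotient field of `D`). -/
abbrev Zar (D K : Type*) [CommRing D] [Field K] [Algebra D K] : Type _ :=
  {V : Overring D K // ValuationRing V}

/-- The space of integrally closed overrings of `D`, with the subspace topology. -/
abbrev IntClosedOverring (D K : Type*) [CommRing D] [Field K] [Algebra D K] : Type _ :=
  {B : Overring D K // IsIntegrallyClosed B}

/-- The closure of `Y` in the inverse topology of the spectral space `X`: the intersection of all
quasi-compact open sets containing `Y`. -/
def inverseClosure {X : Type*} [TopologicalSpace X] (Y : Set X) : Set X :=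
  ⋂₀ {U : Set X | IsOpen U ∧ IsCompact U ∧ Y ⊆ U}

/-- The space `𝓧(X)` of the nonempty subsets of the spectral space `X` that are closed in the
inverse topology. -/
@[ext]
structure InverseClosedSets (X : Type*) [TopologicalSpace X] where
  carrier : Set X
  nonempty : carrier.Nonempty
  inverseClosure_eq : inverseClosure carrier = carrier

/-- The Zariski topology on `𝓧(X)`: a subbase of open sets is given by the sets
`{Y | Y ⊆ Ω}`, where `Ω` runs among the quasi-compact open subsets of `X`. -/
instance InverseClosedSets.zariskiTopology (X : Type*) [TopologicalSpace X] :
    TopologicalSpace (InverseClosedSets X) :=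
  TopologicalSpace.generateFrom
    {U | ∃ Ω : Set X, IsOpen Ω ∧ IsCompact Ω ∧
      U = {Y : InverseClosedSets X | Y.carrier ⊆ Ω}}

/-- The map `Y ↦ ⋂ {V | V ∈ Y}` from `𝓧(Zar(D))` to the overrings of `D`. -/
def interOverring (D K : Type*) [CommRing D] [Field K] [Algebra D K]
    (Y : InverseClosedSets (Zar D K)) : Overring D K :=
  ⨅ V ∈ Y.carrier, V.1

/-- A Prüfer domain: a domain in which every nonzero finitely generated ideal is invertible (as a
fractional ideal). -/
def IsPrueferDomain (D : Type*) [CommRing D] : Prop :=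
  IsDomain D ∧
    ∀ I : Ideal D, I ≠ ⊥ → I.FG → IsUnit (I : FractionalIdeal D⁰ (FractionRing D))

/-! ### Spectrality and compactness from ultrafilter limits. -/

section UltrafilterCriterion

open Filter TopologicalSpace

variable {X : Type*} [t : TopologicalSpace X] {S : Set (Set X)}

/-! The map `Y ↦ ⋂ Y` has the section `Zar.above`, `B ↦ {V | B ≤ V}`, because an integrally closed
domain is the intersection of its valuation overrings. The section is continuous by compactness, and
a continuous map with a continuous section is a quotient map. Valuation overrings and integrally
closed overrings are both stable under ultrafilter limits; this gives the compactness and the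
spectrality. Over a Prüfer domain every overring is integrally closed and every inverse-closed `Y`
equals `Zar.above (⋂ Y)`, so the section is a two-sided inverse. -/

theorem Ultrafilter.le_nhds_of_mem_subbasis (hS : t = generateFrom S) {F : Ultrafilter X} {x : X}
    (hx : ∀ U ∈ S, x ∈ U → U ∈ F) : (F : Filter X) ≤ 𝓝 x := by
  subst hS
  rw [nhds_generateFrom]
  exact le_iInf₂ fun U hU => le_principal_iff.2 (hx U hU.2 hU.1)

theorem isCompact_sInter_of_ultrafilter_limits (hS : t = generateFrom S)
    (hlim : ∀ F : Ultrafilter X, ∃ x, ∀ U ∈ S, x ∈ U ↔ U ∈ F) {f : Set (Set X)} (hf : f ⊆ S) :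
    IsCompact (⋂₀ f) := by
  rw [isCompact_iff_ultrafilter_le_nhds]
  intro F hF
  obtain ⟨x, hx⟩ := hlim F
  refine ⟨x, fun U hU => (hx U (hf hU)).2 ?_,
    F.le_nhds_of_mem_subbasis hS fun U hU => (hx U hU).1⟩
  exact mem_of_superset (le_principal_iff.1 hF) (Set.sInter_subset_of_mem hU)

/-- A space is spectral as soon as it is T0 and its topology has a subbasis such that every
ultrafilter contains the same subbasic sets as some point. -/
theorem SpectralSpace.of_ultrafilter_limits [T0Space X] (hS : t = generateFrom S)
    (hlim : ∀ F : Ultrafilter X, ∃ x, ∀ U ∈ S, x ∈ U ↔ U ∈ F) : SpectralSpace X := by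
  have hcomp := @isCompact_sInter_of_ultrafilter_limits X t S hS hlim
  have hbasis := isTopologicalBasis_of_subbasis hS
  have hrange : Set.range (fun f : {f : Set (Set X) // f.Finite ∧ f ⊆ S} => ⋂₀ f.1) =
      (fun f => ⋂₀ f) '' {f : Set (Set X) | f.Finite ∧ f ⊆ S} := by
    ext U
    simp
  refine { toT0Space := ‹_›, toCompactSpace := ⟨?_⟩, toQuasiSober := ⟨?_⟩,
           toQuasiSeparatedSpace := ?_, toPrespectralSpace := ?_ }
  · simpa using hcomp (Set.empty_subset S)
  · intro Z hZ hZc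
    -- Irreducibility of `Z` is the finite intersection property here; the limit of an ultrafilter
    -- on this filter is the generic point.
    have hne : (generate ({Z} ∪ {U | U ∈ S ∧ (Z ∩ U).Nonempty})).NeBot := by
      rw [generate_neBot_iff]
      intro T hT hfin
      have hfin' : (T \ {Z}).Finite := hfin.sdiff
      have hmem : ∀ U ∈ T \ {Z}, U ∈ S ∧ (Z ∩ U).Nonempty := fun U hU =>
        (hT hU.1).resolve_left hU.2
      have := isIrreducible_iff_sInter.1 hZ hfin'.toFinset
        (fun U hU => by
          rw [hS]
          exact isOpen_generateFrom_of_mem (hmem U (by simpa using hU)).1)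
        (fun U hU => (hmem U (by simpa using hU)).2)
      refine this.mono ?_
      rintro x ⟨hxZ, hx⟩ U hU
      by_cases h : U = Z
      · exact h ▸ hxZ
      · exact hx U (by simpa using ⟨hU, h⟩)
    obtain ⟨x, hx⟩ := hlim (Ultrafilter.of (generate ({Z} ∪ {U | U ∈ S ∧ (Z ∩ U).Nonempty})))
    have hle := Ultrafilter.of_le (generate ({Z} ∪ {U | U ∈ S ∧ (Z ∩ U).Nonempty}))
    have hxZ : x ∈ Z := isClosed_iff_ultrafilter.1 hZc x _
      (Ultrafilter.le_nhds_of_mem_subbasis hS fun U hU => (hx U hU).1)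
      (hle (mem_generate_of_mem (Or.inl rfl)))
    refine ⟨x, (hZc.closure_subset_iff.2 (Set.singleton_subset_iff.2 hxZ)).antisymm ?_⟩
    intro z hz
    rw [← specializes_iff_mem_closure, specializes_iff_pure, hS, nhds_generateFrom]
    refine le_iInf₂ fun U hU => le_principal_iff.2 (mem_pure.2 ?_)
    exact (hx U hU.2).2 (hle (mem_generate_of_mem (Or.inr ⟨hU.2, z, hz, hU.1⟩)))
  · refine QuasiSeparatedSpace.of_isTopologicalBasis (hrange ▸ hbasis) ?_
    intro f g
    rw [← Set.sInter_union]
    exact hcomp (Set.union_subset f.2.2 g.2.2)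
  · refine PrespectralSpace.of_isTopologicalBasis hbasis ?_
    rintro _ ⟨f, hf, rfl⟩
    exact hcomp hf.2

/-- Otherwise `C` and `Ωᶜ` have the finite intersection property, and a limit point lies in `⋂₀ C ⊆
Ω`, which puts `Ω` in an ultrafilter containing `Ωᶜ`. -/
theorem exists_finite_sInter_subset_of_ultrafilter_limits (hS : t = generateFrom S)
    (hlim : ∀ F : Ultrafilter X, ∃ x, ∀ U ∈ S, x ∈ U ↔ U ∈ F) {C : Set (Set X)} (hC : C ⊆ S)
    {Ω : Set X} (hΩ : IsOpen Ω) (hCΩ : ⋂₀ C ⊆ Ω) :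
    ∃ f ⊆ C, f.Finite ∧ ⋂₀ f ⊆ Ω := by
  by_contra! h
  have hne : (generate (C ∪ {Ωᶜ})).NeBot := by
    rw [generate_neBot_iff]
    intro T hT hfin
    obtain ⟨x, hxT, hxΩ⟩ := Set.not_subset.1 <| h (T \ {Ωᶜ})
      (fun U hU => (hT hU.1).resolve_right hU.2) hfin.sdiff
    refine ⟨x, fun U hU => ?_⟩
    by_cases hUΩ : U = Ωᶜ
    · exact hUΩ ▸ hxΩ
    · exact hxT U ⟨hU, hUΩ⟩
  have hle := Ultrafilter.of_le (generate (C ∪ {Ωᶜ}))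
  obtain ⟨x, hx⟩ := hlim (Ultrafilter.of (generate (C ∪ {Ωᶜ})))
  have hxΩ : x ∈ Ω := hCΩ fun U hU =>
    (hx U (hC hU)).2 (hle (mem_generate_of_mem (Or.inl hU)))
  have hΩF : Ω ∈ Ultrafilter.of (generate (C ∪ {Ωᶜ})) :=
    Ultrafilter.le_nhds_of_mem_subbasis hS (fun U hU => (hx U hU).1) (hΩ.mem_nhds hxΩ)
  exact Ultrafilter.compl_mem_iff_notMem.1 (hle (mem_generate_of_mem (Or.inr rfl))) hΩF

end UltrafilterCriterion

/-! ### Spaces of overrings and the quotient map. -/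

section Overring

open Filter TopologicalSpace

variable {D K : Type*} [CommRing D] [Field K] [Algebra D K]

theorem Overring.valuationRing_iff [IsFractionRing D K] (B : Overring D K) :
    ValuationRing B ↔ ∀ x : K, x ∈ B ∨ x⁻¹ ∈ B := by
  rw [ValuationRing.iff_isInteger_or_isInteger B K]
  exact forall_congr' fun x => or_congr
    ⟨fun ⟨y, hy⟩ => hy ▸ y.2, fun h => ⟨⟨x, h⟩, rfl⟩⟩
    ⟨fun ⟨y, hy⟩ => hy ▸ y.2, fun h => ⟨⟨x⁻¹, h⟩, rfl⟩⟩

/-- Polynomials over `K` allow one equation to be tested in all overrings at once. -/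
theorem Overring.isIntegral_iff (B : Overring D K) (x : K) :
    IsIntegral B x ↔
      ∃ p : Polynomial K, p.Monic ∧ p.eval x = 0 ∧ (p.coeffs : Set K) ⊆ (B : Set K) := by
  constructor
  · rintro ⟨p, hp, hx⟩
    refine ⟨p.map (algebraMap B K), hp.map _, by rwa [Polynomial.eval_map], ?_⟩
    intro c hc
    obtain ⟨n, -, rfl⟩ := Polynomial.mem_coeffs_iff.1 hc
    rw [Polynomial.coeff_map]
    exact (p.coeff n).2
  · rintro ⟨p, hp, hx, hc⟩
    refine ⟨p.toSubring B.toSubring hc, (Polynomial.monic_toSubring _ _ hc).2 hp, ?_⟩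
    rw [← Polynomial.eval_map]
    exact (congrArg (Polynomial.eval x) (Polynomial.map_toSubring p B.toSubring hc)).trans hx

theorem Overring.isIntegrallyClosed_iff [IsFractionRing D K] (B : Overring D K) :
    IsIntegrallyClosed B ↔ ∀ (x : K) (p : Polynomial K), p.Monic → p.eval x = 0 →
      (p.coeffs : Set K) ⊆ (B : Set K) → x ∈ B := by
  rw [_root_.isIntegrallyClosed_iff K]
  refine ⟨fun h x p hp hx hc => ?_, fun h x hx => ?_⟩
  · obtain ⟨y, hy⟩ := h ((B.isIntegral_iff x).2 ⟨p, hp, hx, hc⟩)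
    exact hy ▸ y.2
  · obtain ⟨p, hp, hx, hc⟩ := (B.isIntegral_iff x).1 hx
    exact ⟨⟨x, h x p hp hx hc⟩, rfl⟩

theorem Overring.isIntegrallyClosed_of_valuationRing [IsFractionRing D K] (V : Overring D K)
    (hV : ValuationRing V) : IsIntegrallyClosed V := by
  let V' : ValuationSubring K :=
    { V.toSubring with mem_or_inv_mem' := (Overring.valuationRing_iff V).1 hV }
  exact inferInstanceAs (IsIntegrallyClosed V'.toSubring)

/-- The limit of a family of overrings along an ultrafilter. -/
def Overring.ultrafilterLimit {X : Type*} (F : Ultrafilter X) (f : X → Overring D K) :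
    Overring D K where
  carrier := {x | ∀ᶠ a in (F : Filter X), x ∈ f a}
  mul_mem' hx hy := by filter_upwards [hx, hy] with a ha hb using mul_mem ha hb
  add_mem' hx hy := by filter_upwards [hx, hy] with a ha hb using add_mem ha hb
  algebraMap_mem' r := Eventually.of_forall fun a => (f a).algebraMap_mem r

theorem Overring.valuationRing_ultrafilterLimit [IsFractionRing D K] {X : Type*}
    (F : Ultrafilter X) (f : X → Overring D K) (hf : ∀ a, ValuationRing (f a)) :
    ValuationRing (Overring.ultrafilterLimit F f) := by
  rw [Overring.valuationRing_iff]
  exact fun x => Ultrafilter.eventually_or.1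
    (Eventually.of_forall fun a => (Overring.valuationRing_iff _).1 (hf a) x)

theorem Overring.isIntegrallyClosed_ultrafilterLimit [IsFractionRing D K] {X : Type*}
    (F : Ultrafilter X) (f : X → Overring D K) (hf : ∀ a, IsIntegrallyClosed (f a)) :
    IsIntegrallyClosed (Overring.ultrafilterLimit F f) := by
  rw [Overring.isIntegrallyClosed_iff]
  intro x p hp hx hc
  have : ∀ᶠ a in (F : Filter X), ∀ c ∈ p.coeffs, c ∈ f a :=
    (eventually_all_finset _).2 fun c h => hc h
  exact this.mono fun a ha => (Overring.isIntegrallyClosed_iff _).1 (hf a) x p hp hx ha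

theorem Overring.isOpen_setOf_mem {x : K} : IsOpen {B : Overring D K | x ∈ B} :=
  isOpen_generateFrom_of_mem ⟨{x}, Set.finite_singleton x, by simp⟩

theorem Overring.setOf_subset_eq_biInter (F : Set K) :
    {B : Overring D K | F ⊆ (B : Set K)} = ⋂ x ∈ F, {B : Overring D K | x ∈ B} := by
  ext B
  simp [Set.subset_def]

theorem Overring.topology_eq_generateFrom : Overring.zariskiTopology D K =
    generateFrom (Set.range fun x : K => {B : Overring D K | x ∈ B}) := by
  refine le_antisymm (le_generateFrom ?_) (le_generateFrom ?_)
  · rintro _ ⟨x, rfl⟩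
    exact Overring.isOpen_setOf_mem
  · rintro _ ⟨F, hF, rfl⟩
    rw [Overring.setOf_subset_eq_biInter]
    let : TopologicalSpace (Overring D K) :=
      generateFrom (Set.range fun x : K => {B : Overring D K | x ∈ B})
    exact hF.isOpen_biInter fun x _ => isOpen_generateFrom_of_mem ⟨x, rfl⟩

theorem Overring.isCompact_setOf_subset (F : Set K) :
    IsCompact {B : Overring D K | F ⊆ (B : Set K)} := by
  rw [isCompact_iff_ultrafilter_le_nhds]
  intro G hG
  -- The least overring containing `F`: each of its neighbourhoods contains the whole set.
  refine ⟨Algebra.adjoin D F, Algebra.subset_adjoin,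
    G.le_nhds_of_mem_subbasis Overring.topology_eq_generateFrom ?_⟩
  rintro _ ⟨x, rfl⟩ hx
  exact mem_of_superset (le_principal_iff.1 hG) fun B hB => Algebra.adjoin_le hB hx

theorem Overring.isClosed_constructible_isIntegrallyClosed [IsFractionRing D K] :
    IsClosed[constructibleTopology (Overring D K)] {B : Overring D K | IsIntegrallyClosed B} := by
  -- Each integral equation imposes a condition that is clopen in the constructible topology.
  have : {B : Overring D K | IsIntegrallyClosed B} =
      ⋂ q : {q : K × Polynomial K // q.2.Monic ∧ q.2.eval q.1 = 0},
        ({B : Overring D K | (q.1.2.coeffs : Set K) ⊆ (B : Set K)}ᶜ ∪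
          {B : Overring D K | ({q.1.1} : Set K) ⊆ (B : Set K)}) := by
    ext B
    simp only [Set.mem_ofPred_eq, Overring.isIntegrallyClosed_iff, Set.mem_iInter, Subtype.forall,
      Prod.forall, Set.mem_union, Set.mem_compl_iff, Set.singleton_subset_iff, SetLike.mem_coe,
      ← imp_iff_not_or, and_imp]
  rw [this]
  have hopen (F : Set K) (hF : F.Finite) : IsOpen {B : Overring D K | F ⊆ (B : Set K)} :=
    isOpen_generateFrom_of_mem ⟨F, hF, rfl⟩
  have hopen' (F : Set K) (hF : F.Finite) :
      IsOpen[constructibleTopology (Overring D K)] {B : Overring D K | F ⊆ (B : Set K)} :=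
    (Overring.isCompact_setOf_subset F).isOpen_constructibleTopology_of_isOpen (hopen F hF)
  have hopen_compl (F : Set K) (hF : F.Finite) :
      IsOpen[constructibleTopology (Overring D K)] {B : Overring D K | F ⊆ (B : Set K)}ᶜ :=
    IsCompact.isOpen_constructibleTopology_of_isClosed
      (by rw [compl_compl]; exact Overring.isCompact_setOf_subset F) (hopen F hF).isClosed_compl
  refine @isClosed_iInter _ _ (constructibleTopology (Overring D K)) _ fun q =>
    @IsClosed.union _ _ _ (constructibleTopology (Overring D K)) ?_ ?_
  · exact (@isClosed_compl_iff _ (constructibleTopology (Overring D K)) _).2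
      (hopen' _ (Finset.finite_toSet _))
  · exact (@isOpen_compl_iff _ _ (constructibleTopology (Overring D K))).1
      (hopen_compl _ (Set.finite_singleton _))

/-- The subbasic open sets `{B | x ∈ B}` of a subspace of the space of overrings. -/
def Overring.subbasis (P : Overring D K → Prop) : Set (Set {B : Overring D K // P B}) :=
  Set.range fun x : K => {B | x ∈ B.1}

theorem Overring.subtype_topology_eq_generateFrom (P : Overring D K → Prop) :
    (inferInstance : TopologicalSpace {B : Overring D K // P B}) =
      generateFrom (Overring.subbasis P) := by
  change induced _ (Overring.zariskiTopology D K) = _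
  rw [Overring.topology_eq_generateFrom, induced_generateFrom_eq, ← Set.range_comp]
  rfl

theorem Overring.subtype_ultrafilter_limits (P : Overring D K → Prop)
    (hP : ∀ F : Ultrafilter {B : Overring D K // P B}, P (Overring.ultrafilterLimit F Subtype.val))
    (F : Ultrafilter {B : Overring D K // P B}) :
    ∃ x, ∀ U ∈ Overring.subbasis P, x ∈ U ↔ U ∈ F := by
  refine ⟨⟨Overring.ultrafilterLimit F Subtype.val, hP F⟩, ?_⟩
  rintro _ ⟨x, rfl⟩
  rfl

instance Overring.t0Space : T0Space (Overring D K) where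
  t0 B C h := by
    ext x
    exact h.mem_open_iff Overring.isOpen_setOf_mem

theorem IntClosedOverring.spectralSpace [IsFractionRing D K] :
    SpectralSpace (IntClosedOverring D K) :=
  .of_ultrafilter_limits (Overring.subtype_topology_eq_generateFrom _)
    (Overring.subtype_ultrafilter_limits _ fun F =>
      Overring.isIntegrallyClosed_ultrafilterLimit F _ Subtype.prop)

theorem Zar.ultrafilter_limits [IsFractionRing D K] (F : Ultrafilter (Zar D K)) :
    ∃ x, ∀ U ∈ Overring.subbasis fun V : Overring D K => ValuationRing V, x ∈ U ↔ U ∈ F :=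
  Overring.subtype_ultrafilter_limits _ 
    (fun F => Overring.valuationRing_ultrafilterLimit F _ Subtype.prop) F

theorem Zar.isOpen_setOf_mem (x : K) : IsOpen {V : Zar D K | x ∈ V.1} :=
  Overring.isOpen_setOf_mem.preimage continuous_subtype_val

theorem Zar.isCompact_setOf_mem [IsFractionRing D K] (x : K) :
    IsCompact {V : Zar D K | x ∈ V.1} := by
  simpa using isCompact_sInter_of_ultrafilter_limits
    (Overring.subtype_topology_eq_generateFrom _) Zar.ultrafilter_limits
    (f := {{V : Zar D K | x ∈ V.1}}) (by rintro _ rfl; exact ⟨x, rfl⟩)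

theorem mem_interOverring {Y : InverseClosedSets (Zar D K)} {x : K} :
    x ∈ interOverring D K Y ↔ ∀ V ∈ Y.carrier, x ∈ V.1 := by
  simp only [interOverring, Algebra.mem_iInf]

theorem isIntegrallyClosed_interOverring [IsFractionRing D K]
    (Y : InverseClosedSets (Zar D K)) : IsIntegrallyClosed (interOverring D K Y) := by
  rw [Overring.isIntegrallyClosed_iff]
  intro x p hp hx hc
  refine mem_interOverring.2 fun V hV => ?_
  exact (Overring.isIntegrallyClosed_iff V.1).1
    (Overring.isIntegrallyClosed_of_valuationRing V.1 V.2) x p hp hx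
    fun c h => mem_interOverring.1 (hc h) V hV

theorem continuous_interOverring [IsFractionRing D K] : Continuous (interOverring D K) := by
  refine continuous_generateFrom_iff.2 ?_
  rintro _ ⟨F, hF, rfl⟩
  rw [Overring.setOf_subset_eq_biInter, Set.preimage_iInter₂]
  refine hF.isOpen_biInter fun x _ => isOpen_generateFrom_of_mem
    ⟨{V : Zar D K | x ∈ V.1}, Zar.isOpen_setOf_mem x, Zar.isCompact_setOf_mem x, ?_⟩
  ext Y
  exact mem_interOverring

theorem subset_inverseClosure {X : Type*} [TopologicalSpace X] (Y : Set X) :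
    Y ⊆ inverseClosure Y :=
  Set.subset_sInter fun _ hU => hU.2.2

/-- The set of valuation overrings containing a given overring. -/
def Zar.above [IsFractionRing D K] (B : Overring D K) : InverseClosedSets (Zar D K) where
  carrier := {V | B ≤ V.1}
  nonempty := ⟨⟨⊤, (Overring.valuationRing_iff _).2 fun _ => Or.inl trivial⟩, (le_top : B ≤ ⊤)⟩
  inverseClosure_eq := by
    refine Set.Subset.antisymm (fun V hV b hb => ?_) (subset_inverseClosure _)
    exact hV {V : Zar D K | b ∈ V.1} ⟨Zar.isOpen_setOf_mem b, Zar.isCompact_setOf_mem b,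
      fun W hW => hW hb⟩

theorem Zar.mem_above [IsFractionRing D K] {B : Overring D K} {V : Zar D K} :
    V ∈ (Zar.above B).carrier ↔ B ≤ V.1 :=
  Iff.rfl

/-- Compactness: if all valuation rings above `B` lie in `Ω`, finitely many elements of `B` already
force this. -/
theorem Zar.continuous_above [IsFractionRing D K] :
    Continuous (Zar.above : Overring D K → InverseClosedSets (Zar D K)) := by
  refine continuous_generateFrom_iff.2 ?_
  rintro _ ⟨Ω, hΩ, -, rfl⟩
  refine isOpen_iff_forall_mem_open.2 fun B hB => ?_
  obtain ⟨f, hf, hfin, hfΩ⟩ := exists_finite_sInter_subset_of_ultrafilter_limits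
    (Overring.subtype_topology_eq_generateFrom _) Zar.ultrafilter_limits
    (C := (fun x : K => {V : Zar D K | x ∈ V.1}) '' (B : Set K))
    (Set.image_subset_range _ _) hΩ fun V hV =>
      hB (Zar.mem_above.2 fun b hb => hV _ ⟨b, hb, rfl⟩)
  obtain ⟨F, hFB, hFfin, rfl⟩ := Set.exists_subset_image_finite_and.1 ⟨f, hf, hfin, rfl⟩
  refine ⟨{C | F ⊆ (C : Set K)}, fun C hC V hV => hfΩ ?_,
    isOpen_generateFrom_of_mem ⟨F, hFfin, rfl⟩, hFB⟩
  rintro _ ⟨x, hx, rfl⟩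
  exact Zar.mem_above.1 hV (hC hx)

theorem interOverring_above [IsFractionRing D K] (B : Overring D K) [IsIntegrallyClosed B] :
    interOverring D K (Zar.above B) = B := by
  refine le_antisymm (fun x hx => ?_) fun x hx => mem_interOverring.2 fun V hV => Zar.mem_above.1 hV hx
  by_contra hxB
  have : IsIntegrallyClosedIn B.toSubring K :=
    (isIntegrallyClosed_iff_isIntegrallyClosedIn (R := B) K).1 ‹_›
  obtain ⟨V, hBV, hxV⟩ := Subring.exists_le_valuationSubring_of_isIntegrallyClosedIn
    (R := B.toSubring) (x := x) hxB
  let W : Overring D K := { V.toSubring with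
    algebraMap_mem' := fun r => hBV (B.algebraMap_mem r) }
  have hW : ValuationRing W := (Overring.valuationRing_iff W).2 V.mem_or_inv_mem
  exact hxV (mem_interOverring.1 hx ⟨W, hW⟩ (Zar.mem_above.2 fun b hb => hBV (x := b) hb))

theorem isQuotientMap_interOverring [IsFractionRing D K] :
    Topology.IsQuotientMap fun Y : InverseClosedSets (Zar D K) =>
      (⟨interOverring D K Y, isIntegrallyClosed_interOverring Y⟩ : IntClosedOverring D K) :=
  have hσ : Continuous fun B : IntClosedOverring D K => Zar.above B.1 :=
    Zar.continuous_above.comp continuous_subtype_val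
  have hφ := (continuous_interOverring (D := D) (K := K)).subtype_mk
    isIntegrallyClosed_interOverring
  Topology.IsQuotientMap.of_inverse hσ hφ fun B => Subtype.ext
    (have := B.2; interOverring_above B.1)

end Overring

/-! ### Prüfer domains. -/

section Pruefer

variable {D K : Type*} [CommRing D] [Field K] [Algebra D K]

/-- A finitely generated nonzero fractional ideal of a Prüfer domain is invertible, in terms of
elements. -/
theorem IsPrueferDomain.exists_sum_mul_eq_one [IsFractionRing D K] (hD : IsPrueferDomain D)
    {ι : Type*} [Fintype ι] (g : ι → K) (hg : ∃ i, g i ≠ 0) :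
    ∃ h : ι → K, ∑ i, g i * h i = 1 ∧ ∀ i j, h i * g j ∈ (algebraMap D K).range := by
  have := hD.1
  obtain ⟨b, hb⟩ := IsLocalization.exist_integer_multiples_of_finite D⁰ g
  choose a ha using hb
  simp only [Algebra.smul_def] at ha
  have hb0 : algebraMap D K b ≠ 0 := IsFractionRing.to_map_ne_zero_of_mem_nonZeroDivisors b.2
  set I : Ideal D := Ideal.span (Set.range a) with hI
  have hI0 : I ≠ ⊥ := by
    obtain ⟨i, hi⟩ := hg
    intro h
    have h0 : a i = 0 := Ideal.span_eq_bot.1 h _ ⟨i, rfl⟩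
    have := ha i
    rw [h0, map_zero] at this
    exact mul_ne_zero hb0 hi this.symm
  obtain ⟨J, hJ⟩ := (hD.2 I hI0 ⟨Set.finite_range a |>.toFinset, by simp [hI]⟩).exists_right_inv
  -- Elements of `I * J` collapse to one sum over the generators `a i = b * g i`; the factor `b` is
  -- moved onto `h` below.
  have hsum : ∀ z ∈ (I : FractionalIdeal D⁰ (FractionRing D)) * J,
      ∃ h : ι → FractionRing D, (∀ i, h i ∈ J) ∧
        ∑ i, algebraMap D (FractionRing D) (a i) * h i = z := by
    intro z hz
    refine FractionalIdeal.mul_induction_on hz ?_ ?_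
    · intro x hx y hy
      obtain ⟨d, hd, rfl⟩ := (FractionalIdeal.mem_coeIdeal _).1 hx
      obtain ⟨c, rfl⟩ := Ideal.mem_span_range_iff_exists_fun.1 hd
      refine ⟨fun i => c i • y, fun i => Submodule.smul_mem J.1 (c i) hy, ?_⟩
      rw [map_sum, Finset.sum_mul]
      refine Finset.sum_congr rfl fun i _ => ?_
      simp only [Algebra.smul_def, map_mul]
      ring
    · rintro _ _ ⟨h₁, hh₁, rfl⟩ ⟨h₂, hh₂, rfl⟩
      refine ⟨h₁ + h₂, fun i => Submodule.add_mem J.1 (hh₁ i) (hh₂ i), ?_⟩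
      simp only [Pi.add_apply, mul_add, Finset.sum_add_distrib]
  obtain ⟨h, hhJ, hh⟩ := hsum 1 (hJ ▸ FractionalIdeal.one_mem_one _)
  let e : FractionRing D ≃ₐ[D] K := FractionRing.algEquiv D K
  refine ⟨fun i => e (h i) * algebraMap D K b, ?_, fun i j => ?_⟩
  · rw [← map_one e, ← hh, map_sum]
    refine Finset.sum_congr rfl fun i _ => ?_
    rw [map_mul, AlgEquiv.commutes, ha]
    ring
  · have hmem : algebraMap D (FractionRing D) (a j) * h i ∈
        (1 : FractionalIdeal D⁰ (FractionRing D)) := by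
      rw [← hJ]
      exact FractionalIdeal.mul_mem_mul (FractionalIdeal.mem_coeIdeal_of_mem _
        (Ideal.subset_span ⟨j, rfl⟩)) (hhJ i)
    obtain ⟨d, hd⟩ := (FractionalIdeal.mem_one_iff _).1 hmem
    refine ⟨d, ?_⟩
    rw [← e.commutes, hd, map_mul, e.commutes, ha]
    ring

/-- Invert the fractional ideal `(1, x, …, x^(n-1))`, where `n` is the degree of the equation: `x =
∑ x^(i+1) * h i`, and the equation rewrites the top power, so every term lies in `B`. -/
theorem IsPrueferDomain.isIntegrallyClosed_overring [IsFractionRing D K] (hD : IsPrueferDomain D)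
    (B : Overring D K) : IsIntegrallyClosed B := by
  rw [Overring.isIntegrallyClosed_iff]
  intro x p hp hx hc
  have hcoeff (n : ℕ) : p.coeff n ∈ B := by
    by_cases h : p.coeff n = 0
    · rw [h]
      exact zero_mem B
    · exact hc (p.coeff_mem_coeffs h)
  obtain hn | hn := Nat.eq_zero_or_pos p.natDegree
  · rw [hp.natDegree_eq_zero.1 hn] at hx
    simp at hx
  obtain ⟨h, hh, hhB⟩ := hD.exists_sum_mul_eq_one (K := K) (ι := Fin p.natDegree)
    (fun i => x ^ (i : ℕ)) ⟨⟨0, hn⟩, by simp⟩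
  have hmem (i j : Fin p.natDegree) : x ^ (j : ℕ) * h i ∈ B := by
    obtain ⟨d, hd⟩ := hhB i j
    rw [mul_comm, ← hd]
    exact B.algebraMap_mem d
  have hpow : x ^ p.natDegree = -∑ j : Fin p.natDegree, p.coeff j * x ^ (j : ℕ) := by
    rw [Polynomial.eval_eq_sum_range, Finset.sum_range_succ, hp.coeff_natDegree, one_mul] at hx
    rw [Fin.sum_univ_eq_sum_range (fun j => p.coeff j * x ^ j)]
    exact eq_neg_of_add_eq_zero_right hx
  have hsum : x = ∑ i : Fin p.natDegree, x ^ ((i : ℕ) + 1) * h i := by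
    conv_lhs => rw [← mul_one x, ← hh, Finset.mul_sum]
    exact Finset.sum_congr rfl fun i _ => by ring
  rw [hsum]
  refine sum_mem fun i _ => ?_
  obtain hlt | heq := lt_or_eq_of_le (Nat.succ_le_of_lt i.2)
  · exact hmem i ⟨i + 1, hlt⟩
  · change x ^ (Nat.succ i) * h i ∈ B
    rw [heq, hpow, neg_mul, Finset.sum_mul]
    refine neg_mem (sum_mem fun j _ => ?_)
    rw [mul_assoc]
    exact mul_mem (hcoeff j) (hmem i j)

/-- If `V` contains `⋂ Y` but misses a quasi-compact open `Ω ⊇ Y`, finitely many `f ∉ V` have the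
property that each `W ∈ Y` contains one of them. Inverting the ideal of the `f⁻¹` gives `∑ f⁻¹ * h f
= 1` with each `h f` in `⋂ Y ⊆ V`; but each `f⁻¹` lies in the maximal ideal of `V`. -/
theorem IsPrueferDomain.above_interOverring [IsFractionRing D K] (hD : IsPrueferDomain D)
    (Y : InverseClosedSets (Zar D K)) : Zar.above (interOverring D K Y) = Y := by
  ext V
  refine ⟨fun hV => ?_, fun hV => Zar.mem_above.2 fun x hx => mem_interOverring.1 hx V hV⟩
  rw [← Y.inverseClosure_eq]
  rintro Ω ⟨hΩ, hΩc, hYΩ⟩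
  by_contra hVΩ
  have hbasis := TopologicalSpace.isTopologicalBasis_of_subbasis
    (Overring.subtype_topology_eq_generateFrom fun V : Overring D K => ValuationRing V)
  have hcover : Ω ⊆ ⋃ f : {f : K // f ∉ V.1}, {W : Zar D K | f.1 ∈ W.1} := by
    intro W hW
    obtain ⟨_, ⟨s, ⟨-, hs⟩, rfl⟩, hWs, hsΩ⟩ := hbasis.exists_subset_of_mem_open hW hΩ
    -- As `V ∉ Ω`, some element defining the basic neighbourhood of `W` is missing from `V`.
    obtain ⟨U, hU, hVU⟩ : ∃ U ∈ s, V ∉ U := by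
      by_contra! h
      exact hVΩ (hsΩ h)
    obtain ⟨f, rfl⟩ := hs hU
    exact Set.mem_iUnion.2 ⟨⟨f, hVU⟩, hWs _ hU⟩
  obtain ⟨t, ht⟩ := hΩc.elim_finite_subcover _
    (fun f : {f : K // f ∉ V.1} => Zar.isOpen_setOf_mem f.1) hcover
  have hcover_Y (W : Zar D K) (hW : W ∈ Y.carrier) : ∃ f : t, f.1.1 ∈ W.1 := by
    obtain ⟨f, hf, hfW⟩ := Set.mem_iUnion₂.1 (ht (hYΩ hW))
    exact ⟨⟨f, hf⟩, hfW⟩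
  have hne (f : t) : f.1.1 ≠ 0 := fun h => f.1.2 (h ▸ zero_mem V.1)
  obtain ⟨W₀, hW₀⟩ := Y.nonempty
  obtain ⟨f₀, -⟩ := hcover_Y W₀ hW₀
  obtain ⟨h, hsum, hD'⟩ := hD.exists_sum_mul_eq_one (K := K) (ι := t) (fun f => f.1.1⁻¹)
    ⟨f₀, inv_ne_zero (hne f₀)⟩
  have hhV (f : t) : h f ∈ V.1 := by
    refine Zar.mem_above.1 hV (mem_interOverring.2 fun W hW => ?_)
    obtain ⟨f', hf'⟩ := hcover_Y W hW
    obtain ⟨d, hd⟩ := hD' f f'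
    have : h f = algebraMap D K d * f'.1.1 := by
      rw [hd, inv_mul_cancel_right₀ (hne f')]
    rw [this]
    exact mul_mem (W.1.algebraMap_mem d) hf'
  let V' : ValuationSubring K :=
    { V.1.toSubring with mem_or_inv_mem' := (Overring.valuationRing_iff V.1).1 V.2 }
  have hmem (x : K) : x ∈ V' ↔ x ∈ V.1 := Iff.rfl
  have hlt : V'.valuation (∑ f : t, f.1.1⁻¹ * h f) < 1 := by
    refine V'.valuation.map_sum_lt one_ne_zero fun f _ => ?_
    rw [map_mul]
    refine mul_lt_one_of_nonneg_of_lt_one_left zero_le ?_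
      ((V'.valuation_le_one_iff _).2 ((hmem _).2 (hhV f)))
    rw [map_inv₀]
    refine inv_lt_one_of_one_lt₀ (lt_of_not_ge fun hle => f.1.2 ?_)
    exact (hmem _).1 ((V'.valuation_le_one_iff _).1 hle)
  rw [hsum, map_one] at hlt
  exact lt_irrefl _ hlt

theorem IsPrueferDomain.isHomeomorph_interOverring [IsFractionRing D K]
    (hD : IsPrueferDomain D) : IsHomeomorph (interOverring D K) :=
  (Homeomorph.mk
    { toFun := interOverring D K
      invFun := Zar.above
      left_inv := hD.above_interOverring
      right_inv := fun B =>
        have := hD.isIntegrallyClosed_overring B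
        interOverring_above B }
    continuous_interOverring Zar.continuous_above).isHomeomorph

end Pruefer

theorem proposition5p2 {D K : Type*} [CommRing D] [IsDomain D] [Field K] [Algebra D K]
    [IsFractionRing D K] :
    (∃ h : ∀ Y : InverseClosedSets (Zar D K), IsIntegrallyClosed (interOverring D K Y),
      Topology.IsQuotientMap
        (fun Y : InverseClosedSets (Zar D K) =>
          (⟨interOverring D K Y, h Y⟩ : IntClosedOverring D K))) ∧
    (IsClosed[constructibleTopology (Overring D K)]
        {B : Overring D K | IsIntegrallyClosed B} ∧
      SpectralSpace (IntClosedOverring D K)) ∧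
    (IsPrueferDomain D → IsHomeomorph (interOverring D K)) :=
  ⟨⟨isIntegrallyClosed_interOverring, isQuotientMap_interOverring⟩,
    ⟨Overring.isClosed_constructible_isIntegrallyClosed, IntClosedOverring.spectralSpace⟩,
    IsPrueferDomain.isHomeomorph_interOverring⟩
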